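/- Let $(\Omega,\mathcal F,\mathbb P)$ be a complete probability space and $E$ a separable (real) Banach space with its Borel $\sigma$-algebra and dual $E^*$. Let $L^0(E)$ be the set of almost-sure equivalence classes of $E$-valued random variables, and for $1\le p<\infty$ let $L^p(E)=\{\xi\in L^0(E):\mathbb E|\xi|^p<\infty\}$. A set $A\subseteq L^0(E)$ is decomposable if $1_B\xi+1_{B^c}\zeta\in A$ for all $\xi,\zeta\in A$, $B\in\mathcal F$; $\operatorname{dec}A$ is the smallest decomposable set containing $A$, and $\operatorname{cl}_0$ is the closure for convergence in probability. For nonempty $A\subseteq L^0(E)$ let $F_A$ be the closed random set (an almost surely closed-valued multifunction $\Omega\to\mathcal P(E)$ with graph in $\mathcal F\otimes\mathcal B(E)$), unique up to almost sure equality, such that $$\operatorname{cl}_0\operatorname{dec}A=\{\xi\in L^0(E):\xi(\omega)\in F_A(\omega)\text{ for almost every }\omega\},$$ and let $F_\emptyset=\emptyset$. A transition probability kernel $K$ from $(\Omega,\mathcal F)$ to $(E,\mathcal B(E))$ has the barycenter $Y\in L^0(E)$, written $Y=\int_E x\,K(dx)$, if for almost every $\omega$ and every $L\in E^*$ the functional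 $L$ is $K(\omega)$-integrable and $L(Y(\omega))=\int_E L(x)\,K(\omega,dx)$. Let $\mathcal K_0(A)$ be the set of all transition probability kernels $K$ that have a barycenter in $L^0(E)$ and satisfy $K(\omega,F_A(\omega))=1$ for almost every $\omega$. The set $A$ is called $0$-Choquet convex decomposable if $\int_E x\,K(dx)\in A$ for every $K\in\mathcal K_0(A)$. Let $\operatorname{chcd}_0A$ be the intersection of all $0$-Choquet convex decomposable sets containing $A$, and for $1\le p<\infty$ put $$\operatorname{chcd}_pA:=\operatorname{chcd}_0A\cap L^p(E).$$ **Theorem.** Let $\emptyset\ne A\subseteq L^0(E)$ and $1\le s\le p<\infty$. Then: 1. If $\operatorname{chcd}_pA\ne\emptyset$, then $\operatorname{chcd}_0\operatorname{chcd}_pA=\operatorname{chcd}_0A$. 2. $\operatorname{chcd}_p\operatorname{chcd}_0A=\operatorname{chcd}_pA$. 3. $\operatorname{chcd}_p\operatorname{chcd}_pA=\operatorname{chcd}_pA$. 4. $\operatorname{chcd}_p\operatorname{chcd}_sA=\operatorname{chcd}_pA$. 5. If $\operatorname{chcd}_pA\ne\emptyset$, then $\operatorname{chcd}_s\operatorname{chcd}_pA=\operatorname{chcd}_sA$.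 -/

import Mathlib

open MeasureTheory ProbabilityTheory Filter Topology
open scoped ENNReal

namespace ChoquetConvex

variable {Ω E : Type*} [MeasurableSpace Ω] [NormedAddCommGroup E] [NormedSpace ℝ E]
  [MeasurableSpace E]

/-- A set of (classes of) random vectors is decomposable if it contains
`1_B ξ + 1_{Bᶜ} ζ` for all its elements `ξ`, `ζ` and all events `B`. -/
def IsDecomposable {P : Measure Ω} (A : Set (Ω →ₘ[P] E)) : Prop :=
  ∀ ξ ∈ A, ∀ ζ ∈ A, ∀ B : Set Ω, MeasurableSet B → ∀ η : Ω →ₘ[P] E,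
    (∀ᵐ ω ∂P, η ω = B.indicator (⇑ξ) ω + Bᶜ.indicator (⇑ζ) ω) → η ∈ A

/-- The decomposable hull `dec A`. -/
def decHull {P : Measure Ω} (A : Set (Ω →ₘ[P] E)) : Set (Ω →ₘ[P] E) :=
  ⋂₀ {C | A ⊆ C ∧ IsDecomposable C}

/-- The closure `cl₀ A` for convergence in probability. This convergence is metrizable, so the
closure consists of the limits of sequences in `A`. -/
def closureInProb {P : Measure Ω} (A : Set (Ω →ₘ[P] E)) : Set (Ω →ₘ[P] E) :=
  {ξ | ∃ u : ℕ → (Ω →ₘ[P] E), (∀ n, u n ∈ A) ∧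
    TendstoInMeasure P (fun n => ⇑(u n)) atTop (⇑ξ)}

/-- `L⁰(X)`: the classes of measurable selections of a multifunction `X`. -/
def selections (P : Measure Ω) (X : Ω → Set E) : Set (Ω →ₘ[P] E) :=
  {ξ | ∀ᵐ ω ∂P, ξ ω ∈ X ω}

/-- `X` is a closed random set: closed-valued (almost surely), with a measurable graph. -/
def IsClosedRandomSet (P : Measure Ω) (X : Ω → Set E) : Prop :=
  (∀ᵐ ω ∂P, IsClosed (X ω)) ∧ MeasurableSet {q : Ω × E | q.2 ∈ X q.1}

/-- `X` is (a version of) the closed random set `F_A` with `cl₀ dec A = L⁰(F_A)`. If `A` is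
nonempty, there is exactly one such `X` up to almost sure equality; if `A` is empty, then
`X = ∅` is one. -/
def IsAssociatedRandomSet {P : Measure Ω} (A : Set (Ω →ₘ[P] E)) (X : Ω → Set E) : Prop :=
  IsClosedRandomSet P X ∧ closureInProb (decHull A) = selections P X

/-- `y` is the barycenter `∫ x μ(dx)` of `μ`: `L y = ∫ L x μ(dx)` for all `L` in the dual of `E`,
the integrals being required to exist. -/
def IsBarycenter (μ : Measure E) (y : E) : Prop :=
  ∀ L : E →L[ℝ] ℝ, Integrable (fun x => L x) μ ∧ L y = ∫ x, L x ∂μ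

/-- `Y ∈ L⁰(E)` is the barycenter `∫ x K(dx)` of the transition kernel `K`. -/
def IsKernelBarycenter {P : Measure Ω} (K : Kernel Ω E) (Y : Ω →ₘ[P] E) : Prop :=
  ∀ᵐ ω ∂P, IsBarycenter (K ω) (Y ω)

/-- The set `𝒦₀(A)` of all transition probability kernels `K` from `Ω` to `E` with
`K(ω, F_A(ω)) = 1` for almost every `ω` and with a barycenter in `L⁰(E)`. -/
def choquetKernels {P : Measure Ω} (A : Set (Ω →ₘ[P] E)) : Set (Kernel Ω E) :=
  {K | IsMarkovKernel K ∧
    (∀ X : Ω → Set E, IsAssociatedRandomSet A X → ∀ᵐ ω ∂P, K ω (X ω) = 1) ∧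
    ∃ Y : Ω →ₘ[P] E, IsKernelBarycenter K Y}

/-- `A ⊆ L⁰(E)` is `0`-Choquet convex decomposable: it contains the barycenter of every kernel in
`𝒦₀(A)`. -/
def IsChoquetConvexDecomposable {P : Measure Ω} (A : Set (Ω →ₘ[P] E)) : Prop :=
  ∀ K ∈ choquetKernels A, ∀ Y : Ω →ₘ[P] E, IsKernelBarycenter K Y → Y ∈ A

/-- The `0`-Choquet convex decomposable hull `chcd₀ A`. -/
def chcdZero {P : Measure Ω} (A : Set (Ω →ₘ[P] E)) : Set (Ω →ₘ[P] E) :=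
  ⋂₀ {C | A ⊆ C ∧ IsChoquetConvexDecomposable C}

/-- The extended `p`-Choquet convex decomposable hull `chcd_p A = chcd₀ A ∩ L^p(E)` of a subset
`A` of `L⁰(E)`. -/
def chcd {P : Measure Ω} (p : ℝ≥0∞) (A : Set (Ω →ₘ[P] E)) : Set (Ω →ₘ[P] E) :=
  chcdZero A ∩ {ξ | MemLp (⇑ξ) p P}

end ChoquetConvex

namespace ChoquetConvex

section Hulls

variable {Ω E : Type*} [MeasurableSpace Ω] [NormedAddCommGroup E] {P : Measure Ω}

/-! Only the inclusion of `chcdZero A` in `chcdZero (chcd p A)` has content. Dirac kernels turn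
selections into barycenters, so every 0-Choquet convex decomposable `C` contains `closureInProb
(decHull C)`. Hence `chcdZero A` is decomposable and contains the limits in probability of sequences
in `A`. By truncation, a decomposable set with one `p`-integrable element is contained in the
closure of its `p`-integrable part. The rest is formal, apart from the case of an empty hull. -/

lemma subset_decHull (A : Set (Ω →ₘ[P] E)) : A ⊆ decHull A :=
  Set.subset_sInter fun _ hC => hC.1

lemma decHull_subset {A C : Set (Ω →ₘ[P] E)} (hAC : A ⊆ C) (hC : IsDecomposable C) :
    decHull A ⊆ C :=
  Set.sInter_subset_of_mem ⟨hAC, hC⟩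

lemma isDecomposable_sInter {S : Set (Set (Ω →ₘ[P] E))} (hS : ∀ C ∈ S, IsDecomposable C) :
    IsDecomposable (⋂₀ S) :=
  fun ξ hξ ζ hζ B hB η hη C hC => hS C hC ξ (hξ C hC) ζ (hζ C hC) B hB η hη

lemma isDecomposable_decHull (A : Set (Ω →ₘ[P] E)) : IsDecomposable (decHull A) :=
  isDecomposable_sInter fun _ hC => hC.2

lemma subset_closureInProb (A : Set (Ω →ₘ[P] E)) : A ⊆ closureInProb A := fun ξ hξ =>
  ⟨fun _ => ξ, fun _ => hξ, fun ε hε => by simp [hε.not_ge]⟩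

lemma closureInProb_mono {A B : Set (Ω →ₘ[P] E)} (h : A ⊆ B) :
    closureInProb A ⊆ closureInProb B :=
  fun _ ⟨u, hu, hlim⟩ => ⟨u, fun n => h (hu n), hlim⟩

/-- Truncation: if a decomposable set has a `p`-integrable element, then its `p`-integrable
elements are dense in it for convergence in probability. -/
lemma IsDecomposable.subset_closureInProb_inter_memLp [IsFiniteMeasure P] {D : Set (Ω →ₘ[P] E)}
    (hD : IsDecomposable D) {p : ℝ≥0∞} (hne : (D ∩ {ξ | MemLp (⇑ξ) p P}).Nonempty) :
    D ⊆ closureInProb (D ∩ {ξ | MemLp (⇑ξ) p P}) := by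
  obtain ⟨ζ, hζD, hζ⟩ := hne
  intro ξ hξ
  have hB (n : ℕ) : MeasurableSet {ω | ‖ξ ω‖ ≤ n} :=
    measurableSet_le ξ.stronglyMeasurable.norm.measurable measurable_const
  -- Outside the ball of radius `n` the value is `ζ`, not `0`, since `0` need not lie in `D`.
  let f : ℕ → Ω → E := fun n ω =>
    {ω | ‖ξ ω‖ ≤ n}.indicator (⇑ξ) ω + {ω | ‖ξ ω‖ ≤ n}ᶜ.indicator (⇑ζ) ω
  have hf (n : ℕ) : AEStronglyMeasurable (f n) P :=
    ((ξ.stronglyMeasurable.indicator (hB n)).add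
      (ζ.stronglyMeasurable.indicator (hB n).compl)).aestronglyMeasurable
  have hfp (n : ℕ) : MemLp (f n) p P := by
    refine MemLp.add (MemLp.of_bound
      (ξ.stronglyMeasurable.indicator (hB n)).aestronglyMeasurable n (ae_of_all _ fun ω => ?_))
      (MemLp.indicator (hB n).compl hζ)
    by_cases h : ‖ξ ω‖ ≤ n
    · rwa [Set.indicator_of_mem (by exact h)]
    · rw [Set.indicator_of_notMem (by exact h)]
      simp
  have hlim (ω : Ω) : Tendsto (fun n => f n ω) atTop (𝓝 (ξ ω)) := by
    obtain ⟨N, hN⟩ := exists_nat_ge ‖ξ ω‖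
    refine tendsto_const_nhds.congr' ?_
    filter_upwards [eventually_ge_atTop N] with n hn
    have h : ‖ξ ω‖ ≤ n := hN.trans (by exact_mod_cast hn)
    simp [f, h]
  refine ⟨fun n => AEEqFun.mk (f n) (hf n), fun n => ⟨?_, ?_⟩, ?_⟩
  · exact hD ξ hξ ζ hζD _ (hB n) _ (AEEqFun.coeFn_mk _ (hf n))
  · exact (memLp_congr_ae (AEEqFun.coeFn_mk _ (hf n))).2 (hfp n)
  · exact (tendstoInMeasure_of_tendsto_ae hf (ae_of_all _ hlim)).congr_left
      fun n => (AEEqFun.coeFn_mk _ (hf n)).symm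

variable [MeasurableSpace E]

/-- The empty multifunction is associated with the empty set. -/
lemma isAssociatedRandomSet_empty [NeZero P] :
    IsAssociatedRandomSet (∅ : Set (Ω →ₘ[P] E)) (fun _ => ∅) := by
  have hdec : decHull (∅ : Set (Ω →ₘ[P] E)) = ∅ :=
    Set.subset_empty_iff.1 (decHull_subset subset_rfl fun _ h => h.elim)
  -- Here `P ≠ 0` matters: for the zero measure every class is a selection of `∅`.
  have hsel : selections P (fun _ => (∅ : Set E)) = ∅ := by
    ext ξ
    simp [selections, NeZero.ne P]
  have hcl : closureInProb (∅ : Set (Ω →ₘ[P] E)) = ∅ :=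
    Set.eq_empty_of_forall_notMem fun _ ⟨_, hu, _⟩ => hu 0
  exact ⟨⟨by simp, by simp⟩, by rw [hdec, hcl, hsel]⟩

end Hulls

section Choquet

variable {Ω E : Type*} [MeasurableSpace Ω] [NormedAddCommGroup E] [NormedSpace ℝ E]
  [MeasurableSpace E] {P : Measure Ω}

lemma subset_chcdZero (A : Set (Ω →ₘ[P] E)) : A ⊆ chcdZero A :=
  Set.subset_sInter fun _ hC => hC.1

lemma chcdZero_subset {A C : Set (Ω →ₘ[P] E)} (hAC : A ⊆ C)
    (hC : IsChoquetConvexDecomposable C) : chcdZero A ⊆ C :=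
  Set.sInter_subset_of_mem ⟨hAC, hC⟩

/-- The argument runs over each `C` in the family defining `chcdZero B`, so the hull itself need not
be known to be 0-Choquet convex decomposable. -/
lemma chcdZero_subset_chcdZero {A B : Set (Ω →ₘ[P] E)} (h : A ⊆ chcdZero B) :
    chcdZero A ⊆ chcdZero B :=
  Set.subset_sInter fun _ hC => chcdZero_subset (h.trans (chcdZero_subset hC.1 hC.2)) hC.2

lemma chcdZero_idem (A : Set (Ω →ₘ[P] E)) : chcdZero (chcdZero A) = chcdZero A :=
  (chcdZero_subset_chcdZero subset_rfl).antisymm (subset_chcdZero _)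

lemma chcd_subset_chcdZero (p : ℝ≥0∞) (A : Set (Ω →ₘ[P] E)) : chcd p A ⊆ chcdZero A :=
  Set.inter_subset_left

lemma chcd_anti [IsFiniteMeasure P] {s p : ℝ≥0∞} (hsp : s ≤ p) (A : Set (Ω →ₘ[P] E)) :
    chcd p A ⊆ chcd s A :=
  fun _ hξ => ⟨hξ.1, MemLp.mono_exponent hξ.2 hsp⟩

/-- There are no admissible kernels: one would give mass 1 to `∅` at some `ω`. -/
lemma isChoquetConvexDecomposable_empty [NeZero P] :
    IsChoquetConvexDecomposable (∅ : Set (Ω →ₘ[P] E)) := by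
  rintro K ⟨-, hK, -⟩ _ -
  obtain ⟨ω, hω⟩ := (hK _ isAssociatedRandomSet_empty).exists
  simp at hω

lemma chcdZero_empty [NeZero P] : chcdZero (∅ : Set (Ω →ₘ[P] E)) = ∅ :=
  Set.subset_empty_iff.1 (chcdZero_subset subset_rfl isChoquetConvexDecomposable_empty)

variable [BorelSpace E]

lemma isBarycenter_dirac (x : E) : IsBarycenter (Measure.dirac x) x := fun L => by
  have hL : StronglyMeasurable fun x => L x := L.continuous.measurable.stronglyMeasurable
  exact ⟨integrable_dirac' hL (by simp), (integral_dirac' _ x hL).symm⟩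

/-- The Dirac kernels show that a Choquet convex decomposable set contains every selection of its
associated random set. -/
lemma IsChoquetConvexDecomposable.closureInProb_decHull_subset {C : Set (Ω →ₘ[P] E)}
    (hC : IsChoquetConvexDecomposable C) : closureInProb (decHull C) ⊆ C := by
  intro ξ hξ
  have hbar : IsKernelBarycenter (Kernel.deterministic ξ ξ.measurable) ξ :=
    ae_of_all _ fun ω => by
      rw [Kernel.deterministic_apply]
      exact isBarycenter_dirac _
  refine hC (Kernel.deterministic ξ ξ.measurable) ⟨inferInstance, fun X hX => ?_, ξ, hbar⟩ ξ hbar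
  -- All versions `X` have the same selections, so neither existence nor uniqueness of the
  -- associated random set is needed.
  have hmem : ξ ∈ selections P X := hX.2 ▸ hξ
  filter_upwards [hmem] with ω hω
  rw [Kernel.deterministic_apply]
  exact Measure.dirac_apply_of_mem hω

lemma IsChoquetConvexDecomposable.isDecomposable {C : Set (Ω →ₘ[P] E)}
    (hC : IsChoquetConvexDecomposable C) : IsDecomposable C :=
  fun ξ hξ ζ hζ B hB η hη => hC.closureInProb_decHull_subset <| subset_closureInProb _ <|
    isDecomposable_decHull C ξ (subset_decHull C hξ) ζ (subset_decHull C hζ) B hB η hη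

lemma isDecomposable_chcdZero (A : Set (Ω →ₘ[P] E)) : IsDecomposable (chcdZero A) :=
  isDecomposable_sInter fun _ hC => hC.2.isDecomposable

lemma closureInProb_subset_chcdZero (A : Set (Ω →ₘ[P] E)) : closureInProb A ⊆ chcdZero A :=
  Set.subset_sInter fun C hC =>
    (closureInProb_mono (hC.1.trans (subset_decHull C))).trans hC.2.closureInProb_decHull_subset

lemma chcdZero_chcd [IsFiniteMeasure P] {p : ℝ≥0∞} {A : Set (Ω →ₘ[P] E)}
    (hne : (chcd p A).Nonempty) : chcdZero (chcd p A) = chcdZero A :=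
  (chcdZero_subset_chcdZero (chcd_subset_chcdZero p A)).antisymm <|
    ((isDecomposable_chcdZero A).subset_closureInProb_inter_memLp hne).trans
      (closureInProb_subset_chcdZero _)

lemma chcd_chcd_of_nonempty [IsFiniteMeasure P] {q r : ℝ≥0∞} {A : Set (Ω →ₘ[P] E)}
    (hne : (chcd r A).Nonempty) : chcd q (chcd r A) = chcd q A := by
  rw [chcd, chcdZero_chcd hne, chcd]

/-- No nonemptiness is required: if `chcd s A` is empty, so is the smaller `chcd p A`, and the hull
of `∅` is `∅`. -/
lemma chcd_chcd_of_le [IsFiniteMeasure P] [NeZero P] {s p : ℝ≥0∞} (hsp : s ≤ p)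
    (A : Set (Ω →ₘ[P] E)) : chcd p (chcd s A) = chcd p A := by
  rcases (chcd s A).eq_empty_or_nonempty with h | h
  · have hp : chcd p A = ∅ := Set.subset_empty_iff.1 (h ▸ chcd_anti hsp A)
    rw [h, hp, chcd, chcdZero_empty, Set.empty_inter]
  · exact chcd_chcd_of_nonempty h

end Choquet

end ChoquetConvex

theorem theorem7p14 {Ω E : Type*} [MeasurableSpace Ω]
    [NormedAddCommGroup E] [NormedSpace ℝ E] [CompleteSpace E]
    [TopologicalSpace.SeparableSpace E] [MeasurableSpace E] [BorelSpace E]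
    (P : MeasureTheory.Measure Ω) [MeasureTheory.IsProbabilityMeasure P] [P.IsComplete]
    (A : Set (Ω →ₘ[P] E)) (hA : A.Nonempty)
    (s p : ℝ≥0∞) (hs : 1 ≤ s) (hsp : s ≤ p) (hp : p ≠ ∞) :
    ((ChoquetConvex.chcd p A).Nonempty →
      ChoquetConvex.chcdZero (ChoquetConvex.chcd p A) = ChoquetConvex.chcdZero A) ∧
    ChoquetConvex.chcd p (ChoquetConvex.chcdZero A) = ChoquetConvex.chcd p A ∧
    ChoquetConvex.chcd p (ChoquetConvex.chcd p A) = ChoquetConvex.chcd p A ∧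
    ChoquetConvex.chcd p (ChoquetConvex.chcd s A) = ChoquetConvex.chcd p A ∧
    ((ChoquetConvex.chcd p A).Nonempty →
      ChoquetConvex.chcd s (ChoquetConvex.chcd p A) = ChoquetConvex.chcd s A) :=
  ⟨ChoquetConvex.chcdZero_chcd,
    by rw [ChoquetConvex.chcd, ChoquetConvex.chcdZero_idem, ChoquetConvex.chcd],
    ChoquetConvex.chcd_chcd_of_le le_rfl A,
    ChoquetConvex.chcd_chcd_of_le hsp A,
    ChoquetConvex.chcd_chcd_of_nonempty⟩
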